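/- All graphs are simple and undirected, possibly infinite; write $G\to H$ if there is a graph homomorphism from $G$ to $H$, $G\simeq H$ if $G\to H$ and $H\to G$, and $\omega(G)=\sup\{n\in\mathbb{N} : K_n\to G\}\in\mathbb{N}\cup\{\infty\}$. The join $G+H$ is the disjoint union of $G$ and $H$ with all edges between $G$ and $H$ added; the disjunctive product $G*H$ has vertex set $V(G)\times V(H)$ with $(v,w)\sim(v',w')$ iff $v\sim v'$ or $w\sim w'$. For $d\ge 1$, $G/d$ is the graph whose vertices are the $d$-cliques of $G$, with $S\sim T$ iff $S\cap T=\emptyset$ and $s\sim t$ for all $s\in S$, $t\in T$. A sequence $(F_n)_{n\in\mathbb{N}}$ of graphs is a *semiring family* if $F_0=\emptyset$, $F_1\neq\emptyset$, and $F_n+F_m\to F_{n+m}$, $F_n*F_m\to F_{nm}$ for all $n,m\in\mathbb{N}$. For $S\subseteq V(G)$ let $S^\perp$ be the set of vertices adjacent to all vertices in $S$; $S$ is a *flat* if $S^{\perp\perp}=S$, and $\mathrm{rk}(S)=\omega(G|_{S^{\perp\perp}})$. The sequence is *linear-like* if for all $n$ and every flat $S\subseteq V(F_n)$, $\mathrm{rk}(S)$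 is finite and $F_n|_S\simeq F_{\mathrm{rk}(S)}$. For a finite graph $G$, the *$F$-number* is $\min\{n\in\mathbb{N} : G\to F_n\}$ and the *fractional $F$-number* is $\inf\{n/d : n\in\mathbb{N},\ d\ge 1,\ G\to F_n/d\}$. Let $\mathbb{F}$ be any field. For a bilinear pairing $\beta:U\times W\to\mathbb{F}$ of $\mathbb{F}$-vector spaces, let $O_\beta$ be the graph with vertices the pairs $(x,y)\in U\times W$ with $\beta(x,y)=1$, where $(x,y)\sim(x',y')$ iff $\beta(x,y')=\beta(x',y)=0$. Let $F_n:=O_{\langle\cdot,\cdot\rangle_n}$ for the standard pairing $\langle x,y\rangle_n=\sum_{i=1}^n x_iy_i$ on $\mathbb{F}^n\times\mathbb{F}^n$. Then: 1. For every $\beta$, $\omega(O_\beta)=\mathrm{rk}(\beta)$ (both infinite if $\beta$ has infinite rank), and if $\mathrm{rk}(\beta)=n$ is finite, then $O_\beta\simeq F_n$. 2. $(F_n)$ is a linear-like semiring family, and $\omega(F_n)=n$ for every $n\in\mathbb{N}$. 3. For every finite graph $G$ with complement $\bar G$, the $F$-number of $G$ equals the Haemers bound of $\bar G$ over $\mathbb{F}$,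 and the fractional $F$-number of $G$ equals the fractional Haemers bound of $\bar G$ over $\mathbb{F}$; in particular these numbers are well defined, i.e. the sets over which the minima and infima are taken are nonempty. Here the Haemers bound of a finite graph $H$ is the smallest rank of a matrix $M\in\mathbb{F}^{V(H)\times V(H)}$ with $M_{aa}=1$ for all $a$ and $M_{ab}=0$ for all distinct non-adjacent $a,b$ in $H$; the fractional Haemers bound of $H$ is the infimum of $\mathrm{rank}(M)/d$ over all $d\ge1$ and all block matrices $M$ over $\mathbb{F}$ with rows and columns of blocks indexed by $V(H)$ and blocks of size $d\times d$, such that $M_{aa}=I_d$ for all $a$ and $M_{ab}=0$ for all distinct non-adjacent $a,b$ in $H$. -/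

import Mathlib

namespace GraphFamily

universe u v w

/-! ### Graphs (simple, undirected, possibly infinite) -/

/-- `G ⟶ H`: there is a graph homomorphism from `G` to `H`. -/
def HasHom {V : Type u} {W : Type v} (G : SimpleGraph V) (H : SimpleGraph W) : Prop :=
  Nonempty (G →g H)

/-- Homomorphic equivalence of graphs. -/
def HomEquiv {V : Type u} {W : Type v} (G : SimpleGraph V) (H : SimpleGraph W) : Prop :=
  HasHom G H ∧ HasHom H G

/-- The join `G + H`: disjoint union, with every vertex of `G` adjacent to every vertex of `H`. -/
def join {V : Type u} {W : Type v} (G : SimpleGraph V) (H : SimpleGraph W) :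
    SimpleGraph (V ⊕ W) where
  Adj
    | Sum.inl a, Sum.inl b => G.Adj a b
    | Sum.inr a, Sum.inr b => H.Adj a b
    | Sum.inl _, Sum.inr _ => True
    | Sum.inr _, Sum.inl _ => True
  symm := ⟨by
    rintro (a | a) (b | b) h
    · exact G.adj_symm h
    · trivial
    · trivial
    · exact H.adj_symm h⟩
  loopless := ⟨by
    rintro (a | a) h
    · exact G.irrefl h
    · exact H.irrefl h⟩

/-- The disjunctive product `G * H`. -/
def disjProd {V : Type u} {W : Type v} (G : SimpleGraph V) (H : SimpleGraph W) :
    SimpleGraph (V × W) where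
  Adj p q := G.Adj p.1 q.1 ∨ H.Adj p.2 q.2
  symm := ⟨fun _ _ h => h.imp G.adj_symm H.adj_symm⟩
  loopless := ⟨fun _ h => h.elim G.irrefl H.irrefl⟩

/-- The clique number `ω(G) = sup {n | K_n ⟶ G}`, possibly infinite. -/
noncomputable def cliqueNumber {V : Type u} (G : SimpleGraph V) : ℕ∞ :=
  sSup {m : ℕ∞ | ∃ n : ℕ, m = n ∧ HasHom (⊤ : SimpleGraph (Fin n)) G}

/-- The power graph on subsets of `V`: `S ∼ T` if they are disjoint and every `s ∈ S` is adjacent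
to every `t ∈ T`. The condition `S ≠ T` only removes the loop at the empty set, which plays no role
for the fractionalizations `G / d` with `d > 0`. -/
def powerGraph {V : Type u} (G : SimpleGraph V) : SimpleGraph (Set V) where
  Adj S T := S ≠ T ∧ Disjoint S T ∧ ∀ s ∈ S, ∀ t ∈ T, G.Adj s t
  symm := ⟨fun _ _ h => ⟨h.1.symm, h.2.1.symm, fun s hs t ht => (h.2.2 t ht s hs).symm⟩⟩
  loopless := ⟨fun _ h => h.1 rfl⟩

/-- The `d`-fractionalization `G / d`: the subgraph of the power graph induced on the set of
`d`-cliques of `G` (used for `d > 0`). -/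
def fractionalization {V : Type u} (G : SimpleGraph V) (d : ℕ) :
    SimpleGraph {S : Set V | G.IsClique S ∧ S.encard = d} :=
  (powerGraph G).induce {S : Set V | G.IsClique S ∧ S.encard = d}

/-! ### Semiring families and the linear-like condition -/

/-- A semiring family of graphs: `F_0 = ∅`, `F_1 ≠ ∅`, `F_n + F_m ⟶ F_{n+m}` and
`F_n * F_m ⟶ F_{nm}`. -/
structure IsSemiringFamily {V : ℕ → Type u} (F : ∀ n, SimpleGraph (V n)) : Prop where
  zero : IsEmpty (V 0)
  one : Nonempty (V 1)
  add : ∀ n m : ℕ, HasHom (join (F n) (F m)) (F (n + m))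
  mul : ∀ n m : ℕ, HasHom (disjProd (F n) (F m)) (F (n * m))

/-- `S^⊥`: the set of all vertices that are adjacent to all vertices in `S`. -/
def perp {V : Type u} (G : SimpleGraph V) (S : Set V) : Set V :=
  {v | ∀ s ∈ S, G.Adj v s}

/-- Flats are the sets of vertices with `S^⊥⊥ = S`. -/
def IsFlat {V : Type u} (G : SimpleGraph V) (S : Set V) : Prop :=
  perp G (perp G S) = S

/-- The rank of a set of vertices, `rk S = ω(S^⊥⊥)`. -/
noncomputable def rk {V : Type u} (G : SimpleGraph V) (S : Set V) : ℕ∞ :=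
  cliqueNumber (G.induce (perp G (perp G S)))

/-- A sequence of graphs is linear-like if for every flat `S` in `F_n`, the rank `rk S` is finite
and the induced subgraph on `S` is homomorphically equivalent to `F_{rk S}`. -/
def IsLinearLike {V : ℕ → Type u} (F : ∀ n, SimpleGraph (V n)) : Prop :=
  ∀ (n : ℕ) (S : Set (V n)), IsFlat (F n) S →
    ∃ k : ℕ, rk (F n) S = k ∧ HomEquiv ((F n).induce S) (F k)

/-- The `n` with `G ⟶ F_n`. -/
def fNumberSet {V : ℕ → Type u} (F : ∀ n, SimpleGraph (V n)) {X : Type v}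
    (G : SimpleGraph X) : Set ℕ :=
  {n | HasHom G (F n)}

/-- The `F`-number `min {n | G ⟶ F_n}`. -/
noncomputable def fNumber {V : ℕ → Type u} (F : ∀ n, SimpleGraph (V n)) {X : Type v}
    (G : SimpleGraph X) : ℕ :=
  sInf (fNumberSet F G)

/-- The fractions `n / d` with `d > 0` and `G ⟶ F_n / d`. -/
def fracFNumberSet {V : ℕ → Type u} (F : ∀ n, SimpleGraph (V n)) {X : Type v}
    (G : SimpleGraph X) : Set ℝ :=
  {q | ∃ n d : ℕ, 0 < d ∧ HasHom G (fractionalization (F n) d) ∧ q = (n : ℝ) / d}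

/-- The fractional `F`-number `inf {n / d | G ⟶ F_n / d}`. -/
noncomputable def fracFNumber {V : ℕ → Type u} (F : ∀ n, SimpleGraph (V n)) {X : Type v}
    (G : SimpleGraph X) : ℝ :=
  sInf (fracFNumberSet F G)

/-! ### Peeters graphs of bilinear pairings -/

/-- The graph `O_β` of a bilinear pairing `β : U × W → 𝔽`: vertices are the pairs `(x, y)` with
`β(x, y) = 1`, and `(x, y) ∼ (x', y')` if and only if `β(x, y') = β(x', y) = 0`. -/
def peetersGraph {𝔽 : Type u} [Field 𝔽] {U : Type v} {W : Type w} [AddCommGroup U] [Module 𝔽 U]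
    [AddCommGroup W] [Module 𝔽 W] (β : U →ₗ[𝔽] W →ₗ[𝔽] 𝔽) :
    SimpleGraph {p : U × W // β p.1 p.2 = 1} where
  Adj p q := β p.1.1 q.1.2 = 0 ∧ β q.1.1 p.1.2 = 0
  symm := ⟨fun _ _ h => ⟨h.2, h.1⟩⟩
  loopless := ⟨fun p h => one_ne_zero (p.2.symm.trans h.1)⟩

/-- The family `F_n = O_{⟨·,·⟩}` for the standard bilinear pairing `⟨x, y⟩ = ∑ i, x i * y i`
on `𝔽^n × 𝔽^n`. -/
def peetersFamily (𝔽 : Type u) [Field 𝔽] (n : ℕ) :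
    SimpleGraph {p : (Fin n → 𝔽) × (Fin n → 𝔽) //
      (dotProductBilin 𝔽 𝔽 : (Fin n → 𝔽) →ₗ[𝔽] (Fin n → 𝔽) →ₗ[𝔽] 𝔽) p.1 p.2 = 1} :=
  peetersGraph (dotProductBilin 𝔽 𝔽 : (Fin n → 𝔽) →ₗ[𝔽] (Fin n → 𝔽) →ₗ[𝔽] 𝔽)

/-! ### Haemers bounds -/

/-- A matrix (with entries in a possibly noncommutative ring, such as a ring of `d × d` blocks) is a
representation of `H` if its diagonal entries are `1`, and its entries at pairs of distinct
non-adjacent vertices of `H` are `0`. -/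
def IsRepresentation {V : Type u} {R : Type v} [Zero R] [One R] (H : SimpleGraph V)
    (M : Matrix V V R) : Prop :=
  (∀ a, M a a = 1) ∧ ∀ a b, a ≠ b → ¬ H.Adj a b → M a b = 0

/-- The ranks of the matrices over `𝔽` representing `H`. -/
def haemersSet (𝔽 : Type u) [Field 𝔽] {V : Type v} [Fintype V] (H : SimpleGraph V) : Set ℕ :=
  {r | ∃ M : Matrix V V 𝔽, IsRepresentation H M ∧ r = M.rank}

/-- The Haemers bound of `H` over `𝔽`. -/
noncomputable def haemersBound (𝔽 : Type u) [Field 𝔽] {V : Type v} [Fintype V]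
    (H : SimpleGraph V) : ℕ :=
  sInf (haemersSet 𝔽 H)

/-- The quotients `rank M / d`, where `d > 0` and `M` is a matrix of `d × d` blocks over `𝔽`
representing `H` (identity blocks on the diagonal, zero blocks at non-edges); the rank is that of
the flattened matrix over `𝔽` indexed by `V × {1, …, d}`. -/
def fracHaemersSet (𝔽 : Type u) [Field 𝔽] {V : Type v} [Fintype V] (H : SimpleGraph V) : Set ℝ :=
  {q | ∃ (d : ℕ) (M : Matrix V V (Matrix (Fin d) (Fin d) 𝔽)), 0 < d ∧ IsRepresentation H M ∧
    q = ((Matrix.comp V V (Fin d) (Fin d) 𝔽 M).rank : ℝ) / d}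

/-- The fractional Haemers bound of `H` over `𝔽`. -/
noncomputable def fracHaemersBound (𝔽 : Type u) [Field 𝔽] {V : Type v} [Fintype V]
    (H : SimpleGraph V) : ℝ :=
  sInf (fracHaemersSet 𝔽 H)

end GraphFamily

open GraphFamily

/-!
A homomorphism from `G` to a Peeters graph `O_β` is the same thing as a pair of families
`x : V(G) → U`, `y : V(G) → W` with `β (x a) (y a) = 1` for all `a` and `β (x a) (y b) = 0` for
adjacent `a`, `b` (`hasHom_peetersGraph_iff`). Everything follows from reading this in three ways.

* For `G = K_n` it says that the families are biorthogonal, so the functionals `β (x a)` are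
  linearly independent. Conversely, linearly independent functionals on `W` have a biorthogonal
  family in `W` (`exists_biorthogonal`); hence `ω(O_β) = rk β`. Biorthogonal families of length
  `rk β` embed the standard pairing into `β`, and coordinates of `β u` with respect to a basis of
  `range β` recover `β` from the standard pairing, so `O_β ≃ F_{rk β}`.
* The semiring homomorphisms come from `β ⊕ β'` and `β ⊗ β'`. The set `T^⊥` in `O_β` consists of the
  vertices lying in `U' × W'`, where `U'` annihilates the second components of the vertices in `T`
  and `W'` the first components; so a flat of `F_n` induces the Peeters graph of a restriction of
  the standard pairing, and the first part applies to it.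
* For finite `G` it says that the matrix `⟨x a, y b⟩` represents the complement of `G`. A matrix has
  such a factorization through `𝔽^n` for `n` equal to its rank (`exists_dotProduct_eq`), and any
  matrix factoring through `𝔽^n` has rank at most `n`. This is the equality of the `F`-number and
  the Haemers bound. The fractional version reduces to this one, because `G → H / d` if and only if
  the graph obtained from `G` by replacing each vertex with a `d`-clique maps to `H`
  (`hasHom_fractionalization_iff`), and block matrices representing the complement of `G` are the
  matrices representing the complement of that blow-up.
-/

namespace GraphFamily

open Matrix

/-! ### Homomorphisms and clique numbers -/

section Hom

variable {V V' V'' : Type*} {G : SimpleGraph V} {H : SimpleGraph V'} {K : SimpleGraph V''}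

theorem HasHom.trans (h : HasHom G H) (h' : HasHom H K) : HasHom G K :=
  let ⟨f⟩ := h
  let ⟨g⟩ := h'
  ⟨g.comp f⟩

theorem HomEquiv.trans (h : HomEquiv G H) (h' : HomEquiv H K) : HomEquiv G K :=
  ⟨h.1.trans h'.1, h'.2.trans h.2⟩

theorem natCast_le_cliqueNumber {n : ℕ} (h : HasHom (⊤ : SimpleGraph (Fin n)) G) :
    (n : ℕ∞) ≤ cliqueNumber G :=
  le_sSup ⟨n, rfl, h⟩

theorem cliqueNumber_le_iff {c : ℕ∞} :
    cliqueNumber G ≤ c ↔ ∀ n : ℕ, HasHom (⊤ : SimpleGraph (Fin n)) G → (n : ℕ∞) ≤ c := by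
  refine ⟨fun h n hn => (natCast_le_cliqueNumber hn).trans h, fun h => sSup_le ?_⟩
  rintro _ ⟨n, rfl, hn⟩
  exact h n hn

theorem HasHom.cliqueNumber_le (h : HasHom G H) : cliqueNumber G ≤ cliqueNumber H :=
  cliqueNumber_le_iff.2 fun _ hn => natCast_le_cliqueNumber (hn.trans h)

theorem HomEquiv.cliqueNumber_eq (h : HomEquiv G H) : cliqueNumber G = cliqueNumber H :=
  le_antisymm h.1.cliqueNumber_le h.2.cliqueNumber_le

end Hom

/-! ### Homomorphisms to Peeters graphs -/

section Peeters

variable {𝔽 : Type*} [Field 𝔽] {U W : Type*} [AddCommGroup U] [Module 𝔽 U] [AddCommGroup W]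
  [Module 𝔽 W] {β : U →ₗ[𝔽] W →ₗ[𝔽] 𝔽} {V : Type*} {G : SimpleGraph V}

theorem hasHom_peetersGraph_iff :
    HasHom G (peetersGraph β) ↔ ∃ (x : V → U) (y : V → W),
      (∀ a, β (x a) (y a) = 1) ∧ ∀ a b, G.Adj a b → β (x a) (y b) = 0 := by
  constructor
  · rintro ⟨f⟩
    exact ⟨fun a => (f a).1.1, fun a => (f a).1.2, fun a => (f a).2,
      fun a b h => (f.map_rel h).1⟩
  · rintro ⟨x, y, h₁, h₂⟩
    exact ⟨⟨fun a => ⟨(x a, y a), h₁ a⟩, fun h => ⟨h₂ _ _ h, h₂ _ _ h.symm⟩⟩⟩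

theorem hasHom_peetersFamily_iff {n : ℕ} :
    HasHom G (peetersFamily 𝔽 n) ↔ ∃ x y : V → Fin n → 𝔽,
      (∀ a, x a ⬝ᵥ y a = 1) ∧ ∀ a b, G.Adj a b → x a ⬝ᵥ y b = 0 :=
  hasHom_peetersGraph_iff

/-- Finitely many linearly independent functionals admit a biorthogonal family of vectors. -/
theorem exists_biorthogonal {ι : Type*} [Finite ι] [DecidableEq ι] {L : ι → W →ₗ[𝔽] 𝔽}
    (hL : LinearIndependent 𝔽 L) : ∃ y : ι → W, ∀ i j, L i (y j) = if i = j then 1 else 0 := by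
  have key : ∀ j, ∃ w, (∀ i, i ≠ j → L i w = 0) ∧ L j w ≠ 0 := by
    intro j
    by_contra! hcon
    have hmem : L j ∈ Submodule.span 𝔽 (Set.range fun i : {i // i ≠ j} => L i) := by
      refine mem_span_of_iInf_ker_le_ker fun w hw => hcon w fun i hi => ?_
      exact (Submodule.mem_iInf _).1 hw ⟨i, hi⟩
    refine linearIndependent_iff_notMem_span.1 hL j (Submodule.span_mono ?_ hmem)
    rintro _ ⟨i, rfl⟩
    exact ⟨i, by simpa using i.2, rfl⟩
  choose w h₀ h₁ using key
  refine ⟨fun j => (L j (w j))⁻¹ • w j, fun i j => ?_⟩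
  rw [map_smul, smul_eq_mul]
  split_ifs with h
  · subst h
    exact inv_mul_cancel₀ (h₁ i)
  · rw [h₀ j i h, mul_zero]

/-- The cliques of `O_β` are biorthogonal systems; the other half of such a system exists as soon as
the functionals `β (x i)` are linearly independent. -/
theorem hasHom_top_peetersGraph_iff {n : ℕ} :
    HasHom (⊤ : SimpleGraph (Fin n)) (peetersGraph β) ↔
      ∃ x : Fin n → U, LinearIndependent 𝔽 fun i => β (x i) := by
  rw [hasHom_peetersGraph_iff]
  constructor
  · rintro ⟨x, y, h₁, h₀⟩
    refine ⟨x, linearIndependent_iff'.2 fun s c hc j hj => ?_⟩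
    have h := LinearMap.congr_fun hc (y j)
    rw [LinearMap.sum_apply, Finset.sum_eq_single j] at h
    · simpa [h₁] using h
    · intro i _ hij
      simp [h₀ i j hij]
    · exact fun h => absurd hj h
  · rintro ⟨x, hx⟩
    obtain ⟨y, hy⟩ := exists_biorthogonal hx
    exact ⟨x, y, fun a => by simp [hy], fun a b h => by rw [hy, if_neg h]⟩

theorem hasHom_top_peetersGraph_iff_le_rank {n : ℕ} :
    HasHom (⊤ : SimpleGraph (Fin n)) (peetersGraph β) ↔ (n : Cardinal) ≤ LinearMap.rank β := by
  rw [hasHom_top_peetersGraph_iff]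
  constructor
  · rintro ⟨x, hx⟩
    have h : LinearIndependent 𝔽 fun i => (⟨β (x i), x i, rfl⟩ : LinearMap.range β) :=
      LinearIndependent.of_comp (LinearMap.range β).subtype hx
    simpa using h.cardinal_lift_le_rank
  · intro h
    obtain ⟨v, hv⟩ := exists_linearIndependent_of_le_rank h
    choose x hx using fun i => (v i).2
    refine ⟨x, ?_⟩
    simp_rw [hx]
    exact hv.map_injOn (LinearMap.range β).subtype Subtype.val_injective.injOn

theorem cliqueNumber_peetersGraph :
    cliqueNumber (peetersGraph β) = Cardinal.toENat (LinearMap.rank β) := by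
  apply le_antisymm
  · rw [cliqueNumber_le_iff]
    intro n hn
    exact Cardinal.natCast_le_toENat.2 (hasHom_top_peetersGraph_iff_le_rank.1 hn)
  · refine ENat.forall_natCast_le_iff_le.1 fun n hn => natCast_le_cliqueNumber ?_
    exact hasHom_top_peetersGraph_iff_le_rank.2 (Cardinal.natCast_le_toENat.1 hn)

/-- A biorthogonal system of length `n` embeds the standard pairing on `𝔽^n` into `β`. -/
theorem peetersFamily_hasHom_peetersGraph {n : ℕ} (h : (n : Cardinal) ≤ LinearMap.rank β) :
    HasHom (peetersFamily 𝔽 n) (peetersGraph β) := by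
  obtain ⟨x, y, h₁, h₀⟩ :=
    hasHom_peetersGraph_iff.1 (hasHom_top_peetersGraph_iff_le_rank.2 h)
  have hβ : ∀ a b : Fin n → 𝔽, β (∑ i, a i • x i) (∑ j, b j • y j) = a ⬝ᵥ b := by
    intro a b
    simp only [map_sum, LinearMap.sum_apply, map_smul, LinearMap.smul_apply, smul_eq_mul]
    refine Finset.sum_congr rfl fun i _ => ?_
    rw [Finset.sum_eq_single i]
    · rw [h₁, mul_one, mul_comm]
    · intro j _ hij
      rw [h₀ _ _ hij, mul_zero]
    · simp
  rw [hasHom_peetersGraph_iff]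
  refine ⟨fun p => ∑ i, p.1.1 i • x i, fun p => ∑ i, p.1.2 i • y i, fun p => ?_,
    fun p q hpq => ?_⟩
  · rw [hβ]
    exact p.2
  · rw [hβ]
    exact hpq.1

/-- A linear map of rank `r` factors through `𝔽^r`, by coordinates with respect to a basis of its
range. -/
theorem exists_coordinates_of_range {E : Type*} [AddCommGroup E] [Module 𝔽 E] (f : U →ₗ[𝔽] E)
    [FiniteDimensional 𝔽 (LinearMap.range f)] :
    ∃ (c : U → Fin (Module.finrank 𝔽 (LinearMap.range f)) → 𝔽)
      (e : Fin (Module.finrank 𝔽 (LinearMap.range f)) → E), ∀ u, f u = ∑ i, c u i • e i := by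
  let e := Module.finBasis 𝔽 (LinearMap.range f)
  refine ⟨fun u => e.repr (f.rangeRestrict u), fun i => e i, fun u => ?_⟩
  have h := congrArg (LinearMap.range f).subtype (e.sum_repr (f.rangeRestrict u))
  rw [map_sum] at h
  exact h.symm

theorem peetersGraph_hasHom_peetersFamily [FiniteDimensional 𝔽 (LinearMap.range β)] :
    HasHom (peetersGraph β) (peetersFamily 𝔽 (Module.finrank 𝔽 (LinearMap.range β))) := by
  obtain ⟨c, e, h⟩ := exists_coordinates_of_range β
  have hβ : ∀ u w, c u ⬝ᵥ (fun i => e i w) = β u w := by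
    intro u w
    rw [h, LinearMap.sum_apply]
    rfl
  rw [hasHom_peetersFamily_iff]
  refine ⟨fun p => c p.1.1, fun p i => e i p.1.2, fun p => ?_, fun p q hpq => ?_⟩
  · rw [hβ]
    exact p.2
  · rw [hβ]
    exact hpq.1

theorem peetersGraph_homEquiv [FiniteDimensional 𝔽 (LinearMap.range β)] :
    HomEquiv (peetersGraph β) (peetersFamily 𝔽 (Module.finrank 𝔽 (LinearMap.range β))) :=
  ⟨peetersGraph_hasHom_peetersFamily,
    peetersFamily_hasHom_peetersGraph (Module.finrank_eq_rank 𝔽 (LinearMap.range β)).le⟩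

theorem cliqueNumber_peetersGraph_eq_finrank [FiniteDimensional 𝔽 (LinearMap.range β)] :
    cliqueNumber (peetersGraph β) = Module.finrank 𝔽 (LinearMap.range β) := by
  rw [cliqueNumber_peetersGraph, LinearMap.rank, ← Module.finrank_eq_rank]
  exact Cardinal.toENat_nat _

end Peeters

/-! ### The standard family -/

section Family

variable (𝔽 : Type*) [Field 𝔽]

theorem cliqueNumber_peetersFamily (n : ℕ) : cliqueNumber (peetersFamily 𝔽 n) = n := by
  have hinj : Function.Injective
      (dotProductBilin 𝔽 𝔽 : (Fin n → 𝔽) →ₗ[𝔽] (Fin n → 𝔽) →ₗ[𝔽] 𝔽) := fun x y h =>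
    dotProduct_eq x y fun z => LinearMap.congr_fun h z
  refine cliqueNumber_peetersGraph_eq_finrank.trans ?_
  rw [LinearMap.finrank_range_of_inj hinj, Module.finrank_fin_fun]

theorem isSemiringFamily_peetersFamily : IsSemiringFamily (peetersFamily 𝔽) where
  zero := ⟨fun p => zero_ne_one (α := 𝔽) (by simpa using p.2)⟩
  one := ⟨⟨(1, 1), by simp⟩⟩
  add n m := by
    rw [hasHom_peetersFamily_iff]
    refine ⟨Sum.elim (fun p => Fin.append p.1.1 0) (fun q => Fin.append 0 q.1.1),
      Sum.elim (fun p => Fin.append p.1.2 0) (fun q => Fin.append 0 q.1.2), ?_, ?_⟩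
    · rintro (p | p)
      · simpa [dotProduct, Fin.sum_univ_add] using p.2
      · simpa [dotProduct, Fin.sum_univ_add] using p.2
    · rintro (p | p) (q | q) h
      · simpa [dotProduct, Fin.sum_univ_add] using h.1
      · simp [dotProduct, Fin.sum_univ_add]
      · simp [dotProduct, Fin.sum_univ_add]
      · simpa [dotProduct, Fin.sum_univ_add] using h.1
  mul n m := by
    have key : ∀ (a b : Fin n → 𝔽) (c d : Fin m → 𝔽),
        (fun i => a (finProdFinEquiv.symm i).1 * c (finProdFinEquiv.symm i).2) ⬝ᵥ
          (fun i => b (finProdFinEquiv.symm i).1 * d (finProdFinEquiv.symm i).2) =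
          (a ⬝ᵥ b) * (c ⬝ᵥ d) := by
      intro a b c d
      simp only [dotProduct, Finset.sum_mul_sum, ← Fintype.sum_prod_type']
      rw [← finProdFinEquiv.symm.sum_comp]
      exact Finset.sum_congr rfl fun i _ => by ring
    rw [hasHom_peetersFamily_iff]
    refine ⟨fun p i => p.1.1.1 (finProdFinEquiv.symm i).1 * p.2.1.1 (finProdFinEquiv.symm i).2,
      fun p i => p.1.1.2 (finProdFinEquiv.symm i).1 * p.2.1.2 (finProdFinEquiv.symm i).2, ?_, ?_⟩
    · rintro ⟨p, q⟩
      have hp : p.1.1 ⬝ᵥ p.1.2 = 1 := p.2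
      have hq : q.1.1 ⬝ᵥ q.1.2 = 1 := q.2
      rw [key, hp, hq, one_mul]
    · rintro ⟨p, q⟩ ⟨p', q'⟩ h
      rw [key, mul_eq_zero]
      exact h.imp (fun h => h.1) (fun h => h.1)

theorem isLinearLike_peetersFamily : IsLinearLike (peetersFamily 𝔽) := by
  intro n S hS
  let β : (Fin n → 𝔽) →ₗ[𝔽] (Fin n → 𝔽) →ₗ[𝔽] 𝔽 := dotProductBilin 𝔽 𝔽
  let T := perp (peetersFamily 𝔽 n) S
  -- The flat `S = T^⊥` consists of the vertices of `A × B`.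
  let A : Submodule 𝔽 (Fin n → 𝔽) := ⨅ t : T, LinearMap.ker (β.flip t.1.1.2)
  let B : Submodule 𝔽 (Fin n → 𝔽) := ⨅ t : T, LinearMap.ker (β t.1.1.1)
  have hmem : ∀ p, p ∈ S ↔ p.1.1 ∈ A ∧ p.1.2 ∈ B := by
    intro p
    conv_lhs => rw [← show perp (peetersFamily 𝔽 n) T = S from hS]
    simp only [A, B, Submodule.mem_iInf, LinearMap.mem_ker, LinearMap.flip_apply]
    constructor
    · exact fun h => ⟨fun t => (h t.1 t.2).1, fun t => (h t.1 t.2).2⟩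
    · exact fun h t ht => ⟨h.1 ⟨t, ht⟩, h.2 ⟨t, ht⟩⟩
  let γ : A →ₗ[𝔽] B →ₗ[𝔽] 𝔽 := β.domRestrict₁₂ A B
  have hequiv : HomEquiv ((peetersFamily 𝔽 n).induce S) (peetersGraph γ) := by
    constructor
    · rw [hasHom_peetersGraph_iff]
      exact ⟨fun p => ⟨p.1.1.1, ((hmem p.1).1 p.2).1⟩, fun p => ⟨p.1.1.2, ((hmem p.1).1 p.2).2⟩,
        fun p => p.1.2, fun p q h => h.1⟩
    · exact ⟨⟨fun p => ⟨⟨(p.1.1, p.1.2), p.2⟩, (hmem _).2 ⟨p.1.1.2, p.1.2.2⟩⟩, fun h => h⟩⟩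
  refine ⟨Module.finrank 𝔽 (LinearMap.range γ), ?_, hequiv.trans peetersGraph_homEquiv⟩
  rw [rk, show perp (peetersFamily 𝔽 n) (perp (peetersFamily 𝔽 n) S) = S from hS,
    hequiv.cliqueNumber_eq, cliqueNumber_peetersGraph_eq_finrank]

end Family

/-! ### Haemers bounds -/

section Haemers

variable {𝔽 : Type*} [Field 𝔽] {X : Type*} {G : SimpleGraph X}

theorem isRepresentation_compl_iff {R : Type*} [Zero R] [One R] {M : Matrix X X R} :
    IsRepresentation Gᶜ M ↔ (∀ a, M a a = 1) ∧ ∀ a b, G.Adj a b → M a b = 0 := by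
  refine and_congr_right fun _ => ⟨fun h a b hab => h a b hab.ne fun h' => h'.2 hab,
    fun h a b hab hn => h a b ?_⟩
  by_contra hG
  exact hn ⟨hab, hG⟩

/-- The rank factorization of a square matrix. -/
theorem exists_dotProduct_eq [Fintype X] (M : Matrix X X 𝔽) :
    ∃ x y : X → Fin M.rank → 𝔽, ∀ a b, M a b = x a ⬝ᵥ y b := by
  classical
  obtain ⟨c, e, h⟩ := exists_coordinates_of_range M.mulVecLin
  refine ⟨fun a i => e i a, fun b => c (Pi.single b 1), fun a b => ?_⟩
  have hab := congrFun (h (Pi.single b 1)) a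
  rw [mulVecLin_apply, mulVec_single_one, Finset.sum_apply] at hab
  exact hab.trans (Finset.sum_congr rfl fun i _ => mul_comm _ _)

theorem hasHom_peetersFamily_rank [Fintype X] {M : Matrix X X 𝔽} (hM : IsRepresentation Gᶜ M) :
    HasHom G (peetersFamily 𝔽 M.rank) := by
  rw [isRepresentation_compl_iff] at hM
  obtain ⟨x, y, h⟩ := exists_dotProduct_eq M
  refine hasHom_peetersFamily_iff.2 ⟨x, y, fun a => ?_, fun a b hab => ?_⟩
  · rw [← h, hM.1]
  · rw [← h, hM.2 a b hab]

theorem HasHom.exists_isRepresentation [Fintype X] {n : ℕ} (h : HasHom G (peetersFamily 𝔽 n)) :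
    ∃ M : Matrix X X 𝔽, IsRepresentation Gᶜ M ∧ M.rank ≤ n := by
  obtain ⟨x, y, h₁, h₀⟩ := hasHom_peetersFamily_iff.1 h
  refine ⟨Matrix.of x * (Matrix.of y)ᵀ, isRepresentation_compl_iff.2 ⟨h₁, h₀⟩, ?_⟩
  exact (rank_mul_le_left _ _).trans ((rank_le_card_width _).trans_eq (Fintype.card_fin n))

theorem haemersSet_nonempty [Fintype X] : (haemersSet 𝔽 G).Nonempty := by
  classical
  refine ⟨_, (1 : Matrix X X 𝔽), ?_, rfl⟩
  exact ⟨fun a => one_apply_eq a, fun a b h _ => one_apply_ne h⟩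

theorem haemersSet_subset_fNumberSet [Fintype X] :
    haemersSet 𝔽 Gᶜ ⊆ fNumberSet (peetersFamily 𝔽) G := by
  rintro _ ⟨M, hM, rfl⟩
  exact hasHom_peetersFamily_rank hM

theorem fNumber_eq_haemersBound [Fintype X] :
    fNumber (peetersFamily 𝔽) G = haemersBound 𝔽 Gᶜ := by
  have hne : (haemersSet 𝔽 Gᶜ).Nonempty := haemersSet_nonempty
  apply le_antisymm
  · exact Nat.sInf_le (haemersSet_subset_fNumberSet (Nat.sInf_mem hne))
  · obtain ⟨M, hM, hr⟩ := HasHom.exists_isRepresentation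
      (Nat.sInf_mem (hne.mono haemersSet_subset_fNumberSet))
    have hmem : M.rank ∈ haemersSet 𝔽 Gᶜ := ⟨M, hM, rfl⟩
    exact (Nat.sInf_le hmem).trans hr

/-! ### Fractional Haemers bounds -/

/-- The blow-up of `G` in which every vertex is replaced by a `d`-clique. -/
def cliqueBlowup (G : SimpleGraph X) (d : ℕ) : SimpleGraph (X × Fin d) where
  Adj p q := G.Adj p.1 q.1 ∨ p.1 = q.1 ∧ p.2 ≠ q.2
  symm := ⟨fun _ _ h => h.imp G.adj_symm fun h => ⟨h.1.symm, h.2.symm⟩⟩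
  loopless := ⟨fun _ h => h.elim G.irrefl fun h => h.2 rfl⟩

/-- A `d`-clique of `H` together with an enumeration is a homomorphism from `K_d`, which turns maps
into `H / d` into maps of the blow-up. -/
theorem hasHom_fractionalization_iff {Y : Type*} {H : SimpleGraph Y} {d : ℕ} (hd : 0 < d) :
    HasHom G (fractionalization H d) ↔ HasHom (cliqueBlowup G d) H := by
  constructor
  · rintro ⟨f⟩
    have he : ∀ a, Nonempty (Fin d ≃ (f a).1) := by
      intro a
      have hcard := (f a).2.2
      have hfin : (f a).1.Finite := Set.finite_of_encard_eq_coe hcard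
      have := hfin.to_subtype
      refine ⟨(Finite.equivFinOfCardEq ?_).symm⟩
      rw [Nat.card_coe_set_eq, Set.ncard, hcard, ENat.toNat_natCast]
    let e := fun a => (he a).some
    refine ⟨⟨fun p => e p.1 p.2, ?_⟩⟩
    rintro ⟨a, i⟩ ⟨b, j⟩ (h | ⟨hab, hij⟩)
    · exact (f.map_rel h).2.2 _ (e a i).2 _ (e b j).2
    · obtain rfl : a = b := hab
      exact (f a).2.1 (e a i).2 (e a j).2 fun h => hij ((e a).injective (Subtype.ext h))
  · rintro ⟨f⟩
    have hadj : ∀ a i j, i ≠ j → H.Adj (f (a, i)) (f (a, j)) := fun a i j hij =>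
      f.map_rel (Or.inr ⟨rfl, hij⟩)
    refine ⟨⟨fun a => ⟨Set.range fun i => f (a, i), ?_, ?_⟩, ?_⟩⟩
    · rintro _ ⟨i, rfl⟩ _ ⟨j, rfl⟩ hij
      exact hadj a i j fun h => hij (by rw [h])
    · have hinj : Function.Injective fun i => f (a, i) := fun i j hij => by
        by_contra h
        exact (hadj a i j h).ne hij
      rw [← Set.image_univ, hinj.encard_image, Set.encard_univ]
      simp
    · intro a b hab
      have hall : ∀ s ∈ Set.range (fun i => f (a, i)), ∀ t ∈ Set.range (fun i => f (b, i)),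
          H.Adj s t := by
        rintro _ ⟨i, rfl⟩ _ ⟨j, rfl⟩
        exact f.map_rel (Or.inl hab)
      have hdisj : Disjoint (Set.range fun i => f (a, i)) (Set.range fun i => f (b, i)) :=
        Set.disjoint_left.2 fun s hs ht => H.irrefl (hall s hs s ht)
      -- Positivity of `d` enters here: disjoint nonempty sets are distinct.
      refine ⟨fun h => ?_, hdisj, hall⟩
      have hs : f (a, ⟨0, hd⟩) ∈ Set.range fun i => f (a, i) := ⟨_, rfl⟩
      have h' : Set.range (fun i => f (a, i)) = Set.range fun i => f (b, i) := h
      exact Set.disjoint_left.1 hdisj hs (h' ▸ hs)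

theorem isRepresentation_compl_cliqueBlowup_iff {d : ℕ}
    {M : Matrix X X (Matrix (Fin d) (Fin d) 𝔽)} :
    IsRepresentation (cliqueBlowup G d)ᶜ (Matrix.comp X X (Fin d) (Fin d) 𝔽 M) ↔
      IsRepresentation Gᶜ M := by
  simp only [isRepresentation_compl_iff, Matrix.comp_apply]
  constructor
  · rintro ⟨h₁, h₀⟩
    refine ⟨fun a => ?_, fun a b hab => ?_⟩
    · ext i j
      by_cases hij : i = j
      · subst hij
        rw [one_apply_eq]
        exact h₁ (a, i)
      · rw [one_apply_ne hij]
        exact h₀ (a, i) (a, j) (Or.inr ⟨rfl, hij⟩)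
    · ext i j
      exact h₀ (a, i) (b, j) (Or.inl hab)
  · rintro ⟨h₁, h₀⟩
    refine ⟨fun p => by rw [h₁, one_apply_eq], ?_⟩
    rintro ⟨a, i⟩ ⟨b, j⟩ (hab | ⟨hab, hij⟩)
    · rw [h₀ a b hab, Matrix.zero_apply]
    · obtain rfl : a = b := hab
      rw [h₁, one_apply_ne hij]

theorem fracHaemersSet_nonempty [Fintype X] : (fracHaemersSet 𝔽 G).Nonempty := by
  classical
  refine ⟨_, 1, (1 : Matrix X X (Matrix (Fin 1) (Fin 1) 𝔽)), one_pos, ?_, rfl⟩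
  exact ⟨fun a => one_apply_eq a, fun a b h _ => one_apply_ne h⟩

theorem fracHaemersSet_subset_fracFNumberSet [Fintype X] :
    fracHaemersSet 𝔽 Gᶜ ⊆ fracFNumberSet (peetersFamily 𝔽) G := by
  rintro _ ⟨d, M, hd, hM, rfl⟩
  exact ⟨_, d, hd, (hasHom_fractionalization_iff hd).2
    (hasHom_peetersFamily_rank (isRepresentation_compl_cliqueBlowup_iff.2 hM)), rfl⟩

theorem exists_mem_fracHaemersSet_le [Fintype X] {q : ℝ}
    (hq : q ∈ fracFNumberSet (peetersFamily 𝔽) G) : ∃ r ∈ fracHaemersSet 𝔽 Gᶜ, r ≤ q := by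
  obtain ⟨n, d, hd, h, rfl⟩ := hq
  obtain ⟨N, hN, hr⟩ :=
    HasHom.exists_isRepresentation ((hasHom_fractionalization_iff hd).1 h)
  obtain ⟨M, rfl⟩ := (Matrix.comp X X (Fin d) (Fin d) 𝔽).surjective N
  refine ⟨_, ⟨d, M, hd, isRepresentation_compl_cliqueBlowup_iff.1 hN, rfl⟩, ?_⟩
  gcongr

theorem fracFNumber_eq_fracHaemersBound [Fintype X] :
    fracFNumber (peetersFamily 𝔽) G = fracHaemersBound 𝔽 Gᶜ := by
  have hne : (fracHaemersSet 𝔽 Gᶜ).Nonempty := fracHaemersSet_nonempty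
  have hbdd : BddBelow (fracFNumberSet (peetersFamily 𝔽) G) := by
    refine ⟨0, ?_⟩
    rintro _ ⟨n, d, -, -, rfl⟩
    positivity
  apply le_antisymm
  · exact csInf_le_csInf hbdd hne fracHaemersSet_subset_fracFNumberSet
  · refine le_csInf (hne.mono fracHaemersSet_subset_fracFNumberSet) fun q hq => ?_
    obtain ⟨r, hr, hrq⟩ := exists_mem_fracHaemersSet_le hq
    exact (csInf_le (hbdd.mono fracHaemersSet_subset_fracFNumberSet) hr).trans hrq

end Haemers

end GraphFamily

theorem mainTheorem3 (𝔽 : Type*) [Field 𝔽] :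
    -- the graph of an arbitrary bilinear pairing
    (∀ (U W : Type*) [AddCommGroup U] [Module 𝔽 U] [AddCommGroup W] [Module 𝔽 W]
        (β : U →ₗ[𝔽] W →ₗ[𝔽] 𝔽),
      cliqueNumber (peetersGraph β) = Cardinal.toENat (LinearMap.rank β) ∧
      (FiniteDimensional 𝔽 (LinearMap.range β) →
        HomEquiv (peetersGraph β)
          (peetersFamily 𝔽 (Module.finrank 𝔽 (LinearMap.range β))))) ∧
    -- the standard family
    IsSemiringFamily (peetersFamily 𝔽) ∧
    IsLinearLike (peetersFamily 𝔽) ∧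
    (∀ n : ℕ, cliqueNumber (peetersFamily 𝔽 n) = n) ∧
    -- the associated invariants of finite graphs
    (∀ (X : Type*) [Fintype X] (G : SimpleGraph X),
      (fNumberSet (peetersFamily 𝔽) G).Nonempty ∧ (haemersSet 𝔽 Gᶜ).Nonempty ∧
      fNumber (peetersFamily 𝔽) G = haemersBound 𝔽 Gᶜ ∧
      (fracFNumberSet (peetersFamily 𝔽) G).Nonempty ∧ (fracHaemersSet 𝔽 Gᶜ).Nonempty ∧
      fracFNumber (peetersFamily 𝔽) G = fracHaemersBound 𝔽 Gᶜ) :=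
  ⟨fun _ _ _ _ _ _ _ => ⟨cliqueNumber_peetersGraph, fun _ => peetersGraph_homEquiv⟩,
    isSemiringFamily_peetersFamily 𝔽, isLinearLike_peetersFamily 𝔽, cliqueNumber_peetersFamily 𝔽,
    fun _ _ _ => ⟨haemersSet_nonempty.mono haemersSet_subset_fNumberSet, haemersSet_nonempty,
      fNumber_eq_haemersBound,
      fracHaemersSet_nonempty.mono fracHaemersSet_subset_fracFNumberSet, fracHaemersSet_nonempty,
      fracFNumber_eq_fracHaemersBound⟩⟩
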